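/- Let $SO(3)$ and $O(3)$ act on $\otimes^n\mathbb R^3$ ($n\ge 0$) by $g\cdot(v_1\otimes\cdots\otimes v_n)=gv_1\otimes\cdots\otimes gv_n$, and let $\mu_{SO(3)}$, $\mu_{O(3)}$ be the Haar measures of total mass one. Let $D_n=\dim(\otimes^n\mathbb R^3)^{SO(3)}$ be the dimension of the space of hemitropic tensors of order $n$, and $\dim(\otimes^n\mathbb R^3)^{O(3)}$ that of the space of isotropic tensors of order $n$. Say that $\alpha\in\mathbb R$ is a rotation angle of $g\in SO(3)$ if in some positively oriented orthonormal basis $g$ has the matrix $\begin{pmatrix}1&0&0\\0&\cos\alpha&-\sin\alpha\\0&\sin\alpha&\cos\alpha\end{pmatrix}$. Let $U=[0,2\pi)\times[-\tfrac{\pi}{2},\tfrac{\pi}{2}]\times[0,\pi]$, with coordinates $(\phi,\psi,\alpha)$. (1) Every $g\in SO(3)$ has a rotation angle in $[0,\pi]$, and $\operatorname{Tr}(g)=1+2\cos\alpha$ for every rotation angle $\alpha$ of $g$. (2) For every $n\ge 0$ and every choice of a rotation angle $\alpha(g)$ for each $g\in SO(3)$, $$D_n=\int_{SO(3)}\operatorname{Tr}(g)^n\,d\mu_{SO(3)}(g)=\int_{SO(3)}(1+2\cos\alpha(g))^n\,d\mu_{SO(3)}(g)=\frac1{2\pi^2}\int_U(1+2\cos\alpha)^n\cos\psi\,\sin^2\!\left(\frac{\alpha}{2}\right)d\phi\,d\psi\,d\alpha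 .$$ (3) For every $m\ge 0$, $$D_{2m}=\sum_{k=0}^m\binom{2k}{k}\left[\frac32\binom{2m}{2k}-\frac12\binom{2m+1}{2k}\right],$$ $$D_{2m+1}=\sum_{k=0}^m\binom{2k}{k}\left[\frac32\binom{2m+1}{2k}-\frac12\binom{2m+2}{2k}\right]-\frac12\binom{2m+2}{m+1}.$$ (4) For every $n\ge 0$, $$\dim(\otimes^n\mathbb R^3)^{O(3)}=\int_{O(3)}\operatorname{Tr}(g)^n\,d\mu_{O(3)}(g)=\frac1{4\pi^2}\int_U(1+(-1)^n)(1+2\cos\alpha)^n\cos\psi\,\sin^2\!\left(\frac{\alpha}{2}\right)d\phi\,d\psi\,d\alpha,$$ and this equals $D_{2m}$ if $n=2m$ and $0$ if $n=2m+1$. (5) For $n=0,1,2,3,4,5,6,8,15,16,20$, the dimension of the space of hemitropic tensors is $1,0,1,1,3,6,15,91,83097,227475,13393689$ and that of the space of isotropic tensors is $1,0,1,0,3,0,15,91,0,227475,13393689$, respectively. -/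

import Mathlib

open MeasureTheory
open scoped TensorProduct

/-- The rotation group `SO(3)`. -/
abbrev SO3 : Type := Matrix.specialOrthogonalGroup (Fin 3) ℝ

/-- The orthogonal group `O(3)`. -/
abbrev O3 : Type := Matrix.orthogonalGroup (Fin 3) ℝ

/-! ### Compact topological group structure and normalised Haar measure -/

theorem isCompact_orthogonalGroup3 :
    IsCompact (Matrix.orthogonalGroup (Fin 3) ℝ : Set (Matrix (Fin 3) (Fin 3) ℝ)) := by
  have hK : IsCompact (Set.univ.pi fun _ : Fin 3 => Set.univ.pi fun _ : Fin 3 =>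
      Set.Icc (-1 : ℝ) 1) :=
    isCompact_univ_pi fun _ => isCompact_univ_pi fun _ => isCompact_Icc
  have hset : (Matrix.orthogonalGroup (Fin 3) ℝ : Set (Matrix (Fin 3) (Fin 3) ℝ)) =
      {A | A * A.transpose = 1} := by
    ext A
    exact Matrix.mem_orthogonalGroup_iff (Fin 3) ℝ
  rw [hset]
  refine hK.of_isClosed_subset (isClosed_eq (by fun_prop) continuous_const) ?_
  intro (A : Matrix (Fin 3) (Fin 3) ℝ) hA i _ j _
  have h : (A * A.transpose) i i = 1 := by
    rw [show A * A.transpose = 1 from hA, Matrix.one_apply_eq]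
  rw [Matrix.mul_apply] at h
  have hle : A i j * A i j ≤ 1 := by
    rw [← h]
    exact Finset.single_le_sum (f := fun k => A i k * A.transpose k i)
      (fun k _ => mul_self_nonneg (A i k)) (Finset.mem_univ j)
  exact abs_le.1 ((sq_le_one_iff_abs_le_one _).1 (by rw [sq]; exact hle))

theorem isCompact_specialOrthogonalGroup3 :
    IsCompact (Matrix.specialOrthogonalGroup (Fin 3) ℝ : Set (Matrix (Fin 3) (Fin 3) ℝ)) := by
  have hset : (Matrix.specialOrthogonalGroup (Fin 3) ℝ : Set (Matrix (Fin 3) (Fin 3) ℝ)) =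
      (Matrix.orthogonalGroup (Fin 3) ℝ : Set (Matrix (Fin 3) (Fin 3) ℝ)) ∩ {A | A.det = 1} := by
    ext A
    exact Matrix.mem_specialOrthogonalGroup_iff
  rw [hset]
  exact isCompact_orthogonalGroup3.inter_right
    (isClosed_eq (by fun_prop) continuous_const)

instance : CompactSpace SO3 := isCompact_iff_compactSpace.1 isCompact_specialOrthogonalGroup3

instance : CompactSpace O3 := isCompact_iff_compactSpace.1 isCompact_orthogonalGroup3

instance : IsTopologicalGroup SO3 where
  continuous_inv := Continuous.subtype_mk
    (f := fun A : SO3 => (A : Matrix (Fin 3) (Fin 3) ℝ).transpose)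
    continuous_subtype_val.matrix_transpose _

instance : IsTopologicalGroup O3 where
  continuous_inv := Continuous.subtype_mk
    (f := fun A : O3 => (A : Matrix (Fin 3) (Fin 3) ℝ).transpose)
    continuous_subtype_val.matrix_transpose _

instance : MeasurableSpace SO3 := borel SO3
instance : BorelSpace SO3 := ⟨rfl⟩
instance : MeasurableSpace O3 := borel O3
instance : BorelSpace O3 := ⟨rfl⟩

/-- The Haar measure of a compact group `G`, normalised to total mass one. -/
noncomputable def haarProb (G : Type) [Group G] [TopologicalSpace G] [IsTopologicalGroup G]
    [CompactSpace G] [MeasurableSpace G] [BorelSpace G] : Measure G :=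
  Measure.haarMeasure ⊤

/-! ### Tensors of order `n` and their invariants -/

/-- The `n`-th tensor power of a representation: `g` acts by
`g • (v₁ ⊗ ⋯ ⊗ vₙ) = (g v₁) ⊗ ⋯ ⊗ (g vₙ)`. -/
noncomputable def tensorPowerRep {G V : Type} [Group G] [AddCommGroup V] [Module ℝ V]
    (ρ : Representation ℝ G V) (n : ℕ) : Representation ℝ G (⨂[ℝ]^n V) where
  toFun g := PiTensorProduct.map fun _ => ρ g
  map_one' := by
    rw [map_one]
    exact PiTensorProduct.map_one
  map_mul' g h := by
    rw [map_mul]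
    exact PiTensorProduct.map_mul (fun _ => ρ g) (fun _ => ρ h)

/-- The natural representation of `SO(3)` on `ℝ³`, by matrix-vector multiplication. -/
noncomputable def naturalRepSO3 : Representation ℝ SO3 (Fin 3 → ℝ) where
  toFun g := Matrix.toLin' (g : Matrix (Fin 3) (Fin 3) ℝ)
  map_one' := Matrix.toLin'_one
  map_mul' g h := Matrix.toLin'_mul (g : Matrix (Fin 3) (Fin 3) ℝ) (h : Matrix (Fin 3) (Fin 3) ℝ)

/-- The natural representation of `O(3)` on `ℝ³`, by matrix-vector multiplication. -/
noncomputable def naturalRepO3 : Representation ℝ O3 (Fin 3 → ℝ) where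
  toFun g := Matrix.toLin' (g : Matrix (Fin 3) (Fin 3) ℝ)
  map_one' := Matrix.toLin'_one
  map_mul' g h := Matrix.toLin'_mul (g : Matrix (Fin 3) (Fin 3) ℝ) (h : Matrix (Fin 3) (Fin 3) ℝ)

/-- The space of hemitropic tensors of order `n`: the `SO(3)`-invariants of `⊗ⁿ ℝ³`. -/
noncomputable def hemitropicTensors (n : ℕ) : Submodule ℝ (⨂[ℝ]^n (Fin 3 → ℝ)) :=
  (tensorPowerRep naturalRepSO3 n).invariants

/-- The space of isotropic tensors of order `n`: the `O(3)`-invariants of `⊗ⁿ ℝ³`. -/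
noncomputable def isotropicTensors (n : ℕ) : Submodule ℝ (⨂[ℝ]^n (Fin 3 → ℝ)) :=
  (tensorPowerRep naturalRepO3 n).invariants

/-- The dimension `Dₙ` of the space of hemitropic tensors of order `n`. -/
noncomputable def hemitropicDim (n : ℕ) : ℕ := Module.finrank ℝ (hemitropicTensors n)

/-- The dimension of the space of isotropic tensors of order `n`. -/
noncomputable def isotropicDim (n : ℕ) : ℕ := Module.finrank ℝ (isotropicTensors n)

/-! ### Rotation angles and the polar parameter domain -/

/-- `α` is a rotation angle of `g ∈ SO(3)`: in some positively oriented orthonormal basis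
`(n, n⊥, n ∧ n⊥)`, given by the columns of `P`, the matrix of `g` is the rotation of angle `α`
about the first basis vector. -/
def IsRotationAngle (g : SO3) (α : ℝ) : Prop :=
  ∃ P : SO3, (g : Matrix (Fin 3) (Fin 3) ℝ) =
    (P : Matrix (Fin 3) (Fin 3) ℝ) *
      !![1, 0, 0; 0, Real.cos α, -Real.sin α; 0, Real.sin α, Real.cos α] *
      (P : Matrix (Fin 3) (Fin 3) ℝ).transpose

/-- The domain `[0, 2π) × [-π/2, π/2] × [0, π]` of the polar parameters `(φ, ψ, α)`: longitude and
latitude of the axis, and rotation angle. -/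
def polarDomain : Set (ℝ × ℝ × ℝ) :=
  Set.Ico 0 (2 * Real.pi) ×ˢ Set.Icc (-(Real.pi / 2)) (Real.pi / 2) ×ˢ Set.Icc 0 Real.pi

/-! Averaging over a compact group projects onto the invariants, so the dimension is the mean of the
character, here `Tr ^ n` (`finrank_invariants_eq_integral_trace`, `trace_piTensorProduct_map`).

The Haar integral is brought to the angle variable without any change of variables on the group. Put
`s = 1 + Tr`. Left invariance makes the second derivative of `s ^ (n + 1)` along a one-parameter
group integrate to zero. Summed over the three coordinate axes (a Laplacian), with
`SO3.antisymm_sq_sum`, this gives a two-term recursion for the moments of `s`, that of the Catalan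
numbers (`integral_one_add_trace_pow_succ`). The integrals of `(2 + 2 cos α) ^ n` against `(1 - cos
α) / π` obey the same recursion (`integral_weyl_shifted_succ`) and agree at `n = 0`; the binomial
theorem passes from `s` to `Tr`.

The closed formulas come from expanding `(1 + 2 cos α) ^ n`: odd moments of `2 cos α` vanish and
even ones are central binomial coefficients. For `O(3)`, the element `-1` acts by `(-1) ^ n`, so it
kills odd invariants and adds no condition in even order. -/

/-! ### Averaging over a compact group. -/

section HaarProb

variable {G : Type} [Group G] [TopologicalSpace G] [IsTopologicalGroup G]
  [CompactSpace G] [MeasurableSpace G] [BorelSpace G]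

instance : IsProbabilityMeasure (haarProb G) :=
  ⟨Measure.haarMeasure_self (K₀ := (⊤ : TopologicalSpace.PositiveCompacts G))⟩

instance : (haarProb G).IsMulLeftInvariant :=
  inferInstanceAs (Measure.haarMeasure _).IsMulLeftInvariant

theorem Continuous.integrable_haarProb {f : G → ℝ} (hf : Continuous f) :
    Integrable f (haarProb G) :=
  hf.integrable_of_hasCompactSupport (HasCompactSupport.of_compactSpace f)

/-- Averaging over a compact group projects onto the invariants, so the dimension of the
invariants is the mean value of the character. -/
theorem finrank_invariants_eq_integral_trace {V ι : Type} [AddCommGroup V] [Module ℝ V]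
    [Fintype ι] [DecidableEq ι] (ρ : Representation ℝ G V) (b : Module.Basis ι ℝ V)
    (hρ : ∀ i j, Continuous fun g => LinearMap.toMatrix b b (ρ g) i j) :
    (Module.finrank ℝ ρ.invariants : ℝ) = ∫ g, LinearMap.trace ℝ V (ρ g) ∂(haarProb G) := by
  have : Module.Finite ℝ V := Module.Finite.of_basis b
  -- The averaging operator is built from scalar integrals of matrix entries, as `V` carries no
  -- topology.
  set M : Matrix ι ι ℝ := Matrix.of fun i j =>
    ∫ g, LinearMap.toMatrix b b (ρ g) i j ∂(haarProb G)
  have hrepr : ∀ (f : V →ₗ[ℝ] V) v i,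
      b.repr (f v) i = ∑ j, LinearMap.toMatrix b b f i j * b.repr v j := by
    intro f v i
    rw [← LinearMap.toMatrix_mulVec_repr b b f v]
    rfl
  have hP : ∀ v i, b.repr (Matrix.toLin b b M v) i =
      ∫ g, b.repr (ρ g v) i ∂(haarProb G) := by
    intro v i
    rw [hrepr, LinearMap.toMatrix_toLin]
    simp_rw [hrepr]
    rw [integral_finsetSum]
    · simp_rw [integral_mul_const]
      rfl
    · exact fun j _ => ((hρ i j).mul continuous_const).integrable_haarProb
  have hcont : ∀ v i, Continuous fun g => b.repr (ρ g v) i := by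
    intro v i
    simp_rw [hrepr]
    exact continuous_finsetSum _ fun j _ => (hρ i j).mul continuous_const
  have hproj : LinearMap.IsProj ρ.invariants (Matrix.toLin b b M) := by
    constructor
    · intro v h
      refine b.ext_elem fun i => ?_
      rw [hrepr, hP]
      simp_rw [hP, ← integral_const_mul]
      rw [← integral_finsetSum]
      · simp_rw [← hrepr]
        -- Applying `ρ h` to the average only translates the integrand by `h`, so left invariance
        -- makes averages invariant.
        rw [← integral_mul_left_eq_self (μ := haarProb G) (fun g => b.repr (ρ g v) i) h]
        simp only [map_mul, Module.End.mul_apply]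
      · exact fun j _ => (continuous_const.mul (hcont v j)).integrable_haarProb
    · intro v hv
      refine b.ext_elem fun i => ?_
      rw [hP]
      simp_rw [hv _]
      simp
  rw [← hproj.trace, LinearMap.trace_eq_matrix_trace ℝ b, LinearMap.toMatrix_toLin]
  simp_rw [LinearMap.trace_eq_matrix_trace ℝ b, Matrix.trace]
  rw [integral_finsetSum]
  · rfl
  · exact fun j _ => (hρ j j).integrable_haarProb

/-- If the integrals of a smooth family of functions do not depend on the parameter, then the
integral of the derivative vanishes. -/
theorem integral_deriv_eq_zero_of_const {F F' : ℝ → G → ℝ} (hF : ∀ θ, Continuous (F θ))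
    (hF' : Continuous fun x : ℝ × G => F' x.1 x.2)
    (hd : ∀ θ g, HasDerivAt (fun t => F t g) (F' θ g) θ)
    (hinv : ∀ θ, ∫ g, F θ g ∂(haarProb G) = ∫ g, F 0 g ∂(haarProb G)) :
    ∫ g, F' 0 g ∂(haarProb G) = 0 := by
  -- Compactness of `[-1, 1] × G` gives the constant that dominates the derivative.
  obtain ⟨C, hC⟩ := ((isCompact_Icc (a := (-1 : ℝ)) (b := 1)).prod
    (isCompact_univ (X := G))).exists_bound_of_continuousOn hF'.continuousOn
  have h := (hasDerivAt_integral_of_dominated_loc_of_deriv_le (μ := haarProb G) (x₀ := (0 : ℝ))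
    (F := F) (F' := F') (bound := fun _ => C) (s := Set.Icc (-1) 1)
    (Icc_mem_nhds (by norm_num) (by norm_num))
    (Filter.Eventually.of_forall fun θ => (hF θ).integrable_haarProb.aestronglyMeasurable)
    (hF 0).integrable_haarProb
    (hF'.comp (Continuous.prodMk_right (0 : ℝ))).integrable_haarProb.aestronglyMeasurable
    (Filter.Eventually.of_forall fun g θ hθ => hC (θ, g) ⟨hθ, Set.mem_univ g⟩)
    (integrable_const C)
    (Filter.Eventually.of_forall fun g θ _ => hd θ g)).2
  simp_rw [hinv] at h
  exact h.unique (hasDerivAt_const _ _)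

end HaarProb

/-! ### Characters of tensor powers and the effect of `-1`. -/

section TensorPower

theorem toMatrix_piTensorProduct_map (A : Matrix (Fin 3) (Fin 3) ℝ) (n : ℕ)
    (p q : Fin n → Fin 3) :
    LinearMap.toMatrix (Basis.piTensorProduct fun _ : Fin n => Pi.basisFun ℝ (Fin 3))
      (Basis.piTensorProduct fun _ : Fin n => Pi.basisFun ℝ (Fin 3))
      (PiTensorProduct.map fun _ => Matrix.toLin' A) p q = ∏ i, A (p i) (q i) := by
  rw [LinearMap.toMatrix_apply, Basis.piTensorProduct_apply, PiTensorProduct.map_tprod,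
    Basis.piTensorProduct_repr_tprod_apply]
  simp

/-- The diagonal entries are the products `∏ A (p i) (p i)`; summed over all multi-indices `p` they
are the expanded power of the trace. -/
theorem trace_piTensorProduct_map (A : Matrix (Fin 3) (Fin 3) ℝ) (n : ℕ) :
    LinearMap.trace ℝ (⨂[ℝ]^n (Fin 3 → ℝ)) (PiTensorProduct.map fun _ => Matrix.toLin' A) =
      A.trace ^ n := by
  rw [LinearMap.trace_eq_matrix_trace ℝ
    (Basis.piTensorProduct fun _ : Fin n => Pi.basisFun ℝ (Fin 3)), Matrix.trace, Matrix.trace,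
    Fintype.sum_pow]
  simp only [Matrix.diag_apply, toMatrix_piTensorProduct_map]

theorem hemitropicDim_eq_integral_trace (n : ℕ) : (hemitropicDim n : ℝ) =
    ∫ g : SO3, (g : Matrix (Fin 3) (Fin 3) ℝ).trace ^ n ∂(haarProb SO3) := by
  have h := finrank_invariants_eq_integral_trace (tensorPowerRep naturalRepSO3 n)
    (Basis.piTensorProduct fun _ : Fin n => Pi.basisFun ℝ (Fin 3)) fun p q => by
      change Continuous fun g : SO3 => LinearMap.toMatrix _ _
        (PiTensorProduct.map fun _ => Matrix.toLin' (g : Matrix (Fin 3) (Fin 3) ℝ)) p q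
      simp_rw [toMatrix_piTensorProduct_map]
      exact continuous_finsetProd _ fun i _ => continuous_subtype_val.matrix_elem _ _
  refine h.trans (integral_congr_ae (Filter.Eventually.of_forall fun g => ?_))
  exact trace_piTensorProduct_map _ n

theorem isotropicDim_eq_integral_trace (n : ℕ) : (isotropicDim n : ℝ) =
    ∫ g : O3, (g : Matrix (Fin 3) (Fin 3) ℝ).trace ^ n ∂(haarProb O3) := by
  have h := finrank_invariants_eq_integral_trace (tensorPowerRep naturalRepO3 n)
    (Basis.piTensorProduct fun _ : Fin n => Pi.basisFun ℝ (Fin 3)) fun p q => by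
      change Continuous fun g : O3 => LinearMap.toMatrix _ _
        (PiTensorProduct.map fun _ => Matrix.toLin' (g : Matrix (Fin 3) (Fin 3) ℝ)) p q
      simp_rw [toMatrix_piTensorProduct_map]
      exact continuous_finsetProd _ fun i _ => continuous_subtype_val.matrix_elem _ _
  refine h.trans (integral_congr_ae (Filter.Eventually.of_forall fun g => ?_))
  exact trace_piTensorProduct_map _ n

theorem piTensorProduct_map_toLin'_neg (A : Matrix (Fin 3) (Fin 3) ℝ) (n : ℕ)
    (t : ⨂[ℝ]^n (Fin 3 → ℝ)) :
    PiTensorProduct.map (fun _ => Matrix.toLin' (-A)) t =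
      (-1 : ℝ) ^ n • PiTensorProduct.map (fun _ => Matrix.toLin' A) t := by
  have h : (fun _ : Fin n => Matrix.toLin' (-A)) = fun i => (-1 : ℝ) • Matrix.toLin' A := by
    funext i
    rw [map_neg]
    module
  have h2 := (PiTensorProduct.mapMultilinear ℝ (fun _ : Fin n => Fin 3 → ℝ)
    (fun _ : Fin n => Fin 3 → ℝ)).map_smul_univ (fun _ => (-1 : ℝ)) fun _ => Matrix.toLin' A
  simp only [PiTensorProduct.mapMultilinear_apply, Finset.prod_const, Finset.card_univ,
    Fintype.card_fin] at h2
  rw [h, h2, LinearMap.smul_apply]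

theorem isotropicTensors_two_mul (m : ℕ) :
    isotropicTensors (2 * m) = hemitropicTensors (2 * m) := by
  ext t
  constructor
  · intro ht g
    exact ht ⟨g, (Matrix.mem_specialOrthogonalGroup_iff.1 g.2).1⟩
  · intro ht g
    have hdet : (g : Matrix (Fin 3) (Fin 3) ℝ).det * (g : Matrix (Fin 3) (Fin 3) ℝ).det = 1 := by
      have h := congrArg Matrix.det ((Matrix.mem_orthogonalGroup_iff (Fin 3) ℝ).1 g.2)
      rw [Matrix.det_mul, Matrix.det_one] at h
      exact (congrArg _ (Matrix.det_transpose _)).symm.trans h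
    rcases mul_self_eq_one_iff.1 hdet with h | h
    · exact ht ⟨g, Matrix.mem_specialOrthogonalGroup_iff.2 ⟨g.2, h⟩⟩
    -- In odd dimension `-g` has determinant `1` when `g` has `-1`, and both act alike in even
    -- order.
    · have h1 := ht ⟨-g, Matrix.mem_specialOrthogonalGroup_iff.2 ⟨by
        have := (Matrix.mem_orthogonalGroup_iff (Fin 3) ℝ).1 g.2
        rw [Matrix.mem_orthogonalGroup_iff]
        simpa using this, by rw [Matrix.det_neg, h]; norm_num⟩⟩
      have h2 := piTensorProduct_map_toLin'_neg (g : Matrix (Fin 3) (Fin 3) ℝ) (2 * m) t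
      rw [pow_mul, neg_one_sq, one_pow, one_smul] at h2
      exact h2.symm.trans h1

theorem eq_zero_of_eq_neg_one_smul {V : Type*} [AddCommGroup V] [Module ℝ V] {t : V}
    (h : t = (-1 : ℝ) • t) : t = 0 := by
  have h2 : (2 : ℝ) • t = 0 := by linear_combination (norm := module) h
  exact (smul_eq_zero.1 h2).resolve_left two_ne_zero

theorem isotropicTensors_two_mul_add_one (m : ℕ) : isotropicTensors (2 * m + 1) = ⊥ := by
  refine (Submodule.eq_bot_iff _).2 fun t ht => ?_
  have h1 := ht ⟨-1, by rw [Matrix.mem_orthogonalGroup_iff]; simp⟩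
  have h2 := piTensorProduct_map_toLin'_neg 1 (2 * m + 1) t
  have h3 := ht 1
  change PiTensorProduct.map (fun _ => Matrix.toLin' 1) t = t at h3
  rw [h3, Odd.neg_one_pow ⟨m, rfl⟩] at h2
  exact eq_zero_of_eq_neg_one_smul (h1.symm.trans h2)

theorem isotropicDim_two_mul (m : ℕ) : isotropicDim (2 * m) = hemitropicDim (2 * m) := by
  rw [isotropicDim, isotropicTensors_two_mul, hemitropicDim]

theorem isotropicDim_two_mul_add_one (m : ℕ) : isotropicDim (2 * m + 1) = 0 := by
  rw [isotropicDim, isotropicTensors_two_mul_add_one, finrank_bot]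

end TensorPower

/-! ### Integrals in the angle variable. -/

section WeylIntegral

open Real intervalIntegral

/-- The Wallis reduction for powers of the cosine is the recursion of the central binomial
coefficients. -/
theorem integral_two_mul_cos_pow_even (k : ℕ) :
    ∫ α in (0 : ℝ)..π, (2 * cos α) ^ (2 * k) = π * ((2 * k).choose k : ℝ) := by
  induction k with
  | zero => simp
  | succ k ih =>
    have h := integral_cos_pow (a := 0) (b := π) (2 * k)
    simp only [sin_pi, sin_zero, mul_zero, sub_self, zero_div, zero_add] at h
    have hc := Nat.succ_mul_centralBinom_succ k
    rw [Nat.centralBinom_eq_two_mul_choose, Nat.centralBinom_eq_two_mul_choose] at hc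
    have hc' : ((k : ℝ) + 1) * ((2 * (k + 1)).choose (k + 1) : ℝ) =
        2 * (2 * k + 1) * ((2 * k).choose k : ℝ) := by exact_mod_cast hc
    simp only [mul_pow, intervalIntegral.integral_const_mul] at ih ⊢
    rw [show 2 * (k + 1) = 2 * k + 2 by ring] at hc' ⊢
    rw [h]
    push_cast
    have hk : (2 * (k : ℝ) + 2) ≠ 0 := by positivity
    have hk' : ((k : ℝ) + 1) ≠ 0 := by positivity
    have : ((2 * k + 2).choose (k + 1) : ℝ) =
        2 * (2 * k + 1) * ((2 * k).choose k : ℝ) / (k + 1) := by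
      field_simp
      linarith
    rw [this]
    calc (2 : ℝ) ^ (2 * k + 2) * ((2 * k + 1) / (2 * k + 2) * ∫ x in (0 : ℝ)..π, cos x ^ (2 * k))
        = 4 * ((2 * k + 1) / (2 * k + 2)) *
          (2 ^ (2 * k) * ∫ x in (0 : ℝ)..π, cos x ^ (2 * k)) := by ring
      _ = _ := by
        rw [ih]
        field_simp
        ring

theorem integral_two_mul_cos_pow_odd (k : ℕ) :
    ∫ α in (0 : ℝ)..π, (2 * cos α) ^ (2 * k + 1) = 0 := by
  simp only [mul_pow, intervalIntegral.integral_const_mul]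
  have : ∫ x in (0 : ℝ)..π, cos x ^ (2 * k + 1) = 0 := by
    induction k with
    | zero => simp
    | succ k ih =>
      have h := integral_cos_pow (a := 0) (b := π) (2 * k + 1)
      simp only [sin_pi, sin_zero, mul_zero, sub_self, zero_div, zero_add, ih] at h
      exact h
  rw [this, mul_zero]

theorem sum_range_two_mul (f : ℕ → ℝ) (M : ℕ) :
    ∑ j ∈ Finset.range (2 * M), f j =
      ∑ k ∈ Finset.range M, (f (2 * k) + f (2 * k + 1)) := by
  induction M with
  | zero => simp
  | succ M ih =>
    rw [Finset.sum_range_succ, ← ih, show 2 * (M + 1) = 2 * M + 1 + 1 by ring,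
      Finset.sum_range_succ, Finset.sum_range_succ]
    ring

/-- The central trinomial coefficients as integrals. -/
theorem integral_one_add_two_mul_cos_pow {n M : ℕ} (h : n + 1 ≤ 2 * M) :
    ∫ α in (0 : ℝ)..π, (1 + 2 * cos α) ^ n =
      π * ∑ k ∈ Finset.range M, ((2 * k).choose k : ℝ) * (n.choose (2 * k) : ℝ) := by
  have hexp : ∀ α : ℝ, (1 + 2 * cos α) ^ n =
      ∑ j ∈ Finset.range (2 * M), (2 * cos α) ^ j * (n.choose j : ℝ) := by
    intro α
    rw [add_comm, add_pow]
    simp only [one_pow, mul_one]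
    -- Padding with vanishing binomials to the even length `2 * M` lets the terms be paired by
    -- parity.
    refine Finset.sum_subset (Finset.range_mono h) fun j _ hj => ?_
    rw [Nat.choose_eq_zero_of_lt (by simpa using hj)]
    simp
  simp_rw [hexp]
  rw [intervalIntegral.integral_finsetSum fun j _ =>
    (Continuous.intervalIntegrable (by fun_prop) _ _), sum_range_two_mul, Finset.mul_sum]
  refine Finset.sum_congr rfl fun k _ => ?_
  rw [intervalIntegral.integral_mul_const, intervalIntegral.integral_mul_const,
    integral_two_mul_cos_pow_even, integral_two_mul_cos_pow_odd]
  ring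

theorem integral_weyl_eq_sub (n : ℕ) :
    ∫ α in (0 : ℝ)..π, (1 + 2 * cos α) ^ n * (1 - cos α) =
      3 / 2 * (∫ α in (0 : ℝ)..π, (1 + 2 * cos α) ^ n) -
        1 / 2 * ∫ α in (0 : ℝ)..π, (1 + 2 * cos α) ^ (n + 1) := by
  rw [← intervalIntegral.integral_const_mul, ← intervalIntegral.integral_const_mul,
    ← intervalIntegral.integral_sub (Continuous.intervalIntegrable (by fun_prop) _ _)
      (Continuous.intervalIntegrable (by fun_prop) _ _)]
  refine intervalIntegral.integral_congr fun α _ => ?_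
  ring

/-- The difference of the two integrands is the derivative of `2 (2 + 2 cos α) ^ n sin α (1 - cos
α)`, which vanishes at both endpoints. -/
theorem integral_weyl_shifted_succ (n : ℕ) :
    ((n : ℝ) + 2) * (∫ α in (0 : ℝ)..π, (2 + 2 * cos α) ^ (n + 1) * (1 - cos α)) =
      (4 * n + 2) * ∫ α in (0 : ℝ)..π, (2 + 2 * cos α) ^ n * (1 - cos α) := by
  have hd : ∀ α : ℝ, HasDerivAt (fun α => 2 * ((2 + 2 * cos α) ^ n * (sin α * (1 - cos α))))
      (((n : ℝ) + 2) * ((2 + 2 * cos α) ^ (n + 1) * (1 - cos α)) -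
        (4 * n + 2) * ((2 + 2 * cos α) ^ n * (1 - cos α))) α := by
    intro α
    have h1 := ((((hasDerivAt_cos α).const_mul 2).const_add 2).pow n).mul
      ((hasDerivAt_sin α).mul ((hasDerivAt_cos α).const_sub 1))
    refine (h1.const_mul 2).congr_deriv ?_
    have hs : sin α * sin α = 1 - cos α * cos α := by
      linarith [sin_sq_add_cos_sq α, sq (sin α), sq (cos α)]
    rcases n with _ | n
    · simp
      linear_combination 2 * hs
    · simp only [Nat.add_sub_cancel, pow_succ, Pi.pow_apply, Pi.mul_apply]
      push_cast
      linear_combination (2 * (2 + 2 * cos α) ^ n * (2 + 2 * cos α) -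
        4 * (n + 1) * (2 + 2 * cos α) ^ n * (1 - cos α)) * hs
  have h := integral_eq_sub_of_hasDerivAt (a := 0) (b := π) (fun α _ => hd α)
    (Continuous.intervalIntegrable (by fun_prop) _ _)
  rw [intervalIntegral.integral_sub (Continuous.intervalIntegrable (by fun_prop) _ _)
      (Continuous.intervalIntegrable (by fun_prop) _ _),
    intervalIntegral.integral_const_mul, intervalIntegral.integral_const_mul] at h
  simp only [sin_pi, sin_zero, zero_mul, mul_zero, sub_self] at h
  linarith

/-- Since `sin (α / 2) ^ 2 = (1 - cos α) / 2`, the integral factors; longitude contributes `2π` and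
latitude `2`. -/
theorem setIntegral_polarDomain (f : ℝ → ℝ) :
    ∫ u in polarDomain, f u.2.2 * cos u.2.1 * sin (u.2.2 / 2) ^ 2 =
      2 * π * ∫ α in (0 : ℝ)..π, f α * (1 - cos α) := by
  have h1 : ∀ u : ℝ × ℝ × ℝ, f u.2.2 * cos u.2.1 * sin (u.2.2 / 2) ^ 2 =
      (fun _ : ℝ => (1 : ℝ)) u.1 *
        (fun v : ℝ × ℝ => cos v.1 * (f v.2 * (1 - cos v.2) / 2)) u.2 := by
    intro u
    have : cos u.2.2 = 1 - 2 * sin (u.2.2 / 2) ^ 2 := by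
      rw [← cos_two_mul_eq_one_sub, mul_div_cancel₀ _ two_ne_zero]
    simp only [this]
    ring
  simp_rw [h1]
  rw [polarDomain, Measure.volume_eq_prod,
    setIntegral_prod_mul (fun _ => 1) (fun v : ℝ × ℝ => cos v.1 * (f v.2 * (1 - cos v.2) / 2)),
    Measure.volume_eq_prod,
    setIntegral_prod_mul (fun x => cos x) (fun α => f α * (1 - cos α) / 2)]
  rw [integral_Icc_eq_integral_Ioc, integral_Icc_eq_integral_Ioc,
    ← intervalIntegral.integral_of_le (by linarith [pi_pos]),
    ← intervalIntegral.integral_of_le pi_pos.le, integral_cos, sin_neg, sin_pi_div_two,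
    intervalIntegral.integral_div]
  simp [pi_pos.le]
  ring

end WeylIntegral

/-! ### Trace moments on `SO(3)` and existence of rotation angles. -/

section Rotation

open Real Matrix

theorem mem_specialOrthogonalGroup3_iff (A : Matrix (Fin 3) (Fin 3) ℝ) :
    A ∈ Matrix.specialOrthogonalGroup (Fin 3) ℝ ↔ A * A.transpose = 1 ∧ A.det = 1 := by
  rw [Matrix.mem_specialOrthogonalGroup_iff, Matrix.mem_orthogonalGroup_iff]

theorem SO3.mul_transpose (g : SO3) :
    (g : Matrix (Fin 3) (Fin 3) ℝ) * (g : Matrix (Fin 3) (Fin 3) ℝ).transpose = 1 :=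
  ((mem_specialOrthogonalGroup3_iff _).1 g.2).1

theorem SO3.transpose_mul (g : SO3) :
    (g : Matrix (Fin 3) (Fin 3) ℝ).transpose * (g : Matrix (Fin 3) (Fin 3) ℝ) = 1 :=
  mul_eq_one_comm.1 g.mul_transpose

theorem SO3.det_eq_one (g : SO3) : (g : Matrix (Fin 3) (Fin 3) ℝ).det = 1 :=
  ((mem_specialOrthogonalGroup3_iff _).1 g.2).2

theorem IsRotationAngle.trace_eq {g : SO3} {α : ℝ} (h : IsRotationAngle g α) :
    (g : Matrix (Fin 3) (Fin 3) ℝ).trace = 1 + 2 * cos α := by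
  obtain ⟨P, hP⟩ := h
  rw [hP, Matrix.trace_mul_comm, ← Matrix.mul_assoc, P.transpose_mul, Matrix.one_mul,
    Matrix.trace_fin_three]
  simp
  ring

/-- The rotation of angle `α` about the first basis vector. -/
noncomputable def rotationFst (α : ℝ) : SO3 :=
  ⟨!![1, 0, 0; 0, cos α, -sin α; 0, sin α, cos α], by
    have := sin_sq_add_cos_sq α
    rw [mem_specialOrthogonalGroup3_iff]
    constructor
    · ext i j
      fin_cases i <;> fin_cases j <;> simp [Matrix.mul_apply, Fin.sum_univ_three] <;> linarith
    · rw [Matrix.det_fin_three]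
      simp
      linarith⟩

/-- The rotation of angle `α` about the second basis vector. -/
noncomputable def rotationSnd (α : ℝ) : SO3 :=
  ⟨!![cos α, 0, sin α; 0, 1, 0; -sin α, 0, cos α], by
    have := sin_sq_add_cos_sq α
    rw [mem_specialOrthogonalGroup3_iff]
    constructor
    · ext i j
      fin_cases i <;> fin_cases j <;> simp [Matrix.mul_apply, Fin.sum_univ_three] <;> linarith
    · rw [Matrix.det_fin_three]
      simp
      linarith⟩

/-- The rotation of angle `α` about the third basis vector. -/
noncomputable def rotationThd (α : ℝ) : SO3 :=
  ⟨!![cos α, -sin α, 0; sin α, cos α, 0; 0, 0, 1], by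
    have := sin_sq_add_cos_sq α
    rw [mem_specialOrthogonalGroup3_iff]
    constructor
    · ext i j
      fin_cases i <;> fin_cases j <;> simp [Matrix.mul_apply, Fin.sum_univ_three] <;> linarith
    · rw [Matrix.det_fin_three]
      simp
      linarith⟩

/-- Infinitesimal invariance of the Haar measure along a one-parameter group `R`, under which the
trace varies as `A + B cos θ + C sin θ`. -/
theorem integral_trace_variation {A B C : SO3 → ℝ} (hA : Continuous A) (hB : Continuous B)
    (hC : Continuous C) (R : ℝ → SO3)
    (hRA : ∀ θ g, A (R θ * g) = A g)
    (hRB : ∀ θ g, B (R θ * g) = B g * cos θ + C g * sin θ)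
    (hRC : ∀ θ g, C (R θ * g) = C g * cos θ - B g * sin θ) (n : ℕ) :
    ∫ g, (n * (A g + B g) ^ (n - 1) * C g ^ 2 - (A g + B g) ^ n * B g) ∂(haarProb SO3) = 0 := by
  -- With `s = A + B` along the orbit, `C` is the derivative of `s`, so the test function is `s ^ n
  -- * s'`.
  have h := integral_deriv_eq_zero_of_const
    (F := fun θ g => (A g + (B g * cos θ + C g * sin θ)) ^ n * (C g * cos θ - B g * sin θ))
    (F' := fun θ g => n * (A g + (B g * cos θ + C g * sin θ)) ^ (n - 1) *
      (C g * cos θ - B g * sin θ) ^ 2 -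
        (A g + (B g * cos θ + C g * sin θ)) ^ n * (B g * cos θ + C g * sin θ))
    (fun θ => by fun_prop) (by fun_prop) (fun θ g => by
      have hb := ((hasDerivAt_cos θ).const_mul (B g)).add ((hasDerivAt_sin θ).const_mul (C g))
      have hc := ((hasDerivAt_cos θ).const_mul (C g)).sub ((hasDerivAt_sin θ).const_mul (B g))
      refine (((hb.const_add (A g)).pow n).mul hc).congr_deriv ?_
      simp only [Pi.add_apply, Pi.pow_apply, Pi.sub_apply]
      ring)
    (fun θ => by
      have := integral_mul_left_eq_self (μ := haarProb SO3) (fun g => (A g + B g) ^ n * C g) (R θ)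
      simp only [hRA, hRB, hRC] at this
      simpa using this)
  simpa using h

/-- Two trace identities suffice: `g * gᵀ = 1` makes the squared entries sum to `3`, and `adjugate g
= gᵀ` makes the principal 2×2 minors sum to `Tr g`. The factor `1 + Tr g` is why the moments of `1 +
Tr` satisfy a two-term recursion. -/
theorem SO3.antisymm_sq_sum (g : SO3) :
    ((g : Matrix (Fin 3) (Fin 3) ℝ) 1 2 - (g : Matrix (Fin 3) (Fin 3) ℝ) 2 1) ^ 2 +
      ((g : Matrix (Fin 3) (Fin 3) ℝ) 2 0 - (g : Matrix (Fin 3) (Fin 3) ℝ) 0 2) ^ 2 +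
      ((g : Matrix (Fin 3) (Fin 3) ℝ) 0 1 - (g : Matrix (Fin 3) (Fin 3) ℝ) 1 0) ^ 2 =
    (3 - (g : Matrix (Fin 3) (Fin 3) ℝ).trace) * (1 + (g : Matrix (Fin 3) (Fin 3) ℝ).trace) := by
  have hadj : (g : Matrix (Fin 3) (Fin 3) ℝ).adjugate =
      (g : Matrix (Fin 3) (Fin 3) ℝ).transpose := by
    have h := Matrix.adjugate_mul (g : Matrix (Fin 3) (Fin 3) ℝ)
    rw [g.det_eq_one, one_smul] at h
    calc _ = (g : Matrix (Fin 3) (Fin 3) ℝ).adjugate *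
          ((g : Matrix (Fin 3) (Fin 3) ℝ) * (g : Matrix (Fin 3) (Fin 3) ℝ).transpose) := by
            rw [g.mul_transpose, mul_one]
      _ = _ := by rw [← mul_assoc, h, one_mul]
  have ht := congrArg Matrix.trace g.mul_transpose
  have ht' := congrArg Matrix.trace hadj
  simp [Matrix.trace_fin_three, Matrix.mul_apply, Fin.sum_univ_three] at ht
  rw [Matrix.adjugate_fin_three] at ht'
  simp [Matrix.trace_fin_three] at ht'
  rw [Matrix.trace_fin_three]
  linear_combination ht + 2 * ht'

theorem integral_one_add_trace_pow_succ (n : ℕ) :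
    ((n : ℝ) + 2) * (∫ g : SO3, (1 + (g : Matrix (Fin 3) (Fin 3) ℝ).trace) ^ (n + 1)
      ∂(haarProb SO3)) =
      (4 * n + 2) * ∫ g : SO3, (1 + (g : Matrix (Fin 3) (Fin 3) ℝ).trace) ^ n
        ∂(haarProb SO3) := by
  -- Entries become opaque functions, so that `fun_prop` can use their continuity `hc`.
  obtain ⟨e, he⟩ : ∃ e : Fin 3 → Fin 3 → SO3 → ℝ,
      ∀ i j g, e i j g = (g : Matrix (Fin 3) (Fin 3) ℝ) i j := ⟨_, fun _ _ _ => rfl⟩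
  have hc : ∀ i j, Continuous (e i j) := fun i j =>
    (continuous_subtype_val.matrix_elem i j).congr fun g => (he i j g).symm
  have hct : Continuous fun g : SO3 => (g : Matrix (Fin 3) (Fin 3) ℝ).trace :=
    continuous_subtype_val.matrix_trace
  have h0 := integral_trace_variation
    (A := fun g => 1 + e 0 0 g)
    (B := fun g => e 1 1 g + e 2 2 g)
    (C := fun g => e 1 2 g - e 2 1 g)
    (by fun_prop) (by fun_prop) (by fun_prop) rotationFst
    (by intro θ g; simp [he, rotationFst, Matrix.mul_apply, Fin.sum_univ_three])
    (by intro θ g; simp [he, rotationFst, Matrix.mul_apply, Fin.sum_univ_three]; ring)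
    (by intro θ g; simp [he, rotationFst, Matrix.mul_apply, Fin.sum_univ_three]; ring) n
  have h1 := integral_trace_variation
    (A := fun g => 1 + e 1 1 g)
    (B := fun g => e 0 0 g + e 2 2 g)
    (C := fun g => e 2 0 g - e 0 2 g)
    (by fun_prop) (by fun_prop) (by fun_prop) rotationSnd
    (by intro θ g; simp [he, rotationSnd, Matrix.mul_apply, Fin.sum_univ_three])
    (by intro θ g; simp [he, rotationSnd, Matrix.mul_apply, Fin.sum_univ_three]; ring)
    (by intro θ g; simp [he, rotationSnd, Matrix.mul_apply, Fin.sum_univ_three]; ring) n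
  have h2 := integral_trace_variation
    (A := fun g => 1 + e 2 2 g)
    (B := fun g => e 0 0 g + e 1 1 g)
    (C := fun g => e 0 1 g - e 1 0 g)
    (by fun_prop) (by fun_prop) (by fun_prop) rotationThd
    (by intro θ g; simp [he, rotationThd, Matrix.mul_apply, Fin.sum_univ_three])
    (by intro θ g; simp [he, rotationThd, Matrix.mul_apply, Fin.sum_univ_three]; ring)
    (by intro θ g; simp [he, rotationThd, Matrix.mul_apply, Fin.sum_univ_three]; ring) n
  have hsum := congrArg₂ (· + ·) (congrArg₂ (· + ·) h0 h1) h2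
  simp only [add_zero] at hsum
  rw [← integral_add (Continuous.integrable_haarProb (by fun_prop))
      (Continuous.integrable_haarProb (by fun_prop)),
    ← integral_add (Continuous.integrable_haarProb (by fun_prop))
      (Continuous.integrable_haarProb (by fun_prop))] at hsum
  rw [← sub_eq_zero, ← integral_const_mul, ← integral_const_mul,
    ← integral_sub (Continuous.integrable_haarProb (by fun_prop))
      (Continuous.integrable_haarProb (by fun_prop)), ← neg_eq_zero, ← integral_neg, ← hsum]
  refine integral_congr_ae (Filter.Eventually.of_forall fun g => ?_)
  have hsq := g.antisymm_sq_sum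
  have htr := Matrix.trace_fin_three (g : Matrix (Fin 3) (Fin 3) ℝ)
  simp only [← he] at hsq htr
  set s := 1 + (g : Matrix (Fin 3) (Fin 3) ℝ).trace with hs
  -- At `n = 0` the truncated exponent is harmless because of the factor `n`.
  have hpow : (n : ℝ) * s ^ n = n * s ^ (n - 1) * s := by
    rcases n with _ | n
    · simp
    · simp [pow_succ, mul_assoc]
  dsimp only
  have e0 : 1 + e 0 0 g + (e 1 1 g +
    e 2 2 g) = s := by rw [hs, htr]; ring
  have e1 : 1 + e 1 1 g + (e 0 0 g +
    e 2 2 g) = s := by rw [hs, htr]; ring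
  have e2 : 1 + e 2 2 g + (e 0 0 g +
    e 1 1 g) = s := by rw [hs, htr]; ring
  rw [e0, e1, e2]
  have hs' : (g : Matrix (Fin 3) (Fin 3) ℝ).trace = s - 1 := by rw [hs]; ring
  rw [hs'] at hsq htr
  -- The squares `C ^ 2` sum to `(4 - s) * s` and the terms `B` to `2 * (s - 1)`.
  linear_combination -(n * s ^ (n - 1)) * hsq + (4 - s) * hpow - 2 * s ^ n * htr

theorem exists_SO3_firstColumn {v : Fin 3 → ℝ} (hv : v 0 ^ 2 + v 1 ^ 2 + v 2 ^ 2 = 1) :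
    ∃ P : SO3, ∀ i, (P : Matrix (Fin 3) (Fin 3) ℝ) i 0 = v i := by
  by_cases h : v 0 ^ 2 + v 1 ^ 2 = 0
  · have h0 : v 0 = 0 := by nlinarith [sq_nonneg (v 0), sq_nonneg (v 1)]
    have h1 : v 1 = 0 := by nlinarith [sq_nonneg (v 0), sq_nonneg (v 1)]
    have h2 : v 2 * v 2 = 1 := by rw [h0, h1] at hv; linarith
    refine ⟨⟨!![0, 1, 0; 0, 0, v 2; v 2, 0, 0], ?_⟩, ?_⟩
    · rw [mem_specialOrthogonalGroup3_iff]
      constructor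
      · ext i j
        fin_cases i <;> fin_cases j <;> simp [Matrix.mul_apply, Fin.sum_univ_three, h2]
      · rw [Matrix.det_fin_three]
        simp [h2]
    · intro i
      fin_cases i <;> simp [h0, h1]
  · have hpos : 0 < v 0 ^ 2 + v 1 ^ 2 := lt_of_le_of_ne (by positivity) (Ne.symm h)
    obtain ⟨r, hr0, hr⟩ : ∃ r : ℝ, r ≠ 0 ∧ r ^ 2 = v 0 ^ 2 + v 1 ^ 2 :=
      ⟨√(v 0 ^ 2 + v 1 ^ 2), (Real.sqrt_pos.2 hpos).ne', Real.sq_sqrt hpos.le⟩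
    -- The columns are `v`, the horizontal unit vector orthogonal to it, and their cross product.
    refine ⟨⟨!![v 0, -v 1 / r, -v 0 * v 2 / r; v 1, v 0 / r, -v 1 * v 2 / r; v 2, 0, r], ?_⟩, ?_⟩
    · rw [mem_specialOrthogonalGroup3_iff]
      have h2 : v 2 ^ 2 = 1 - r ^ 2 := by linarith
      have h0 : v 0 ^ 2 = r ^ 2 - v 1 ^ 2 := by linarith
      constructor
      · ext i j
        fin_cases i <;> fin_cases j <;> simp [Matrix.mul_apply, Fin.sum_univ_three] <;>
          field_simp <;> ring_nf <;> simp only [h2, h0] <;> ring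
      · rw [Matrix.det_fin_three]
        simp
        field_simp
        ring_nf
        simp only [h2, h0]
        ring
    · intro i
      fin_cases i <;> simp

theorem exists_unit_fixed (g : SO3) : ∃ v : Fin 3 → ℝ, v 0 ^ 2 + v 1 ^ 2 + v 2 ^ 2 = 1 ∧
    (g : Matrix (Fin 3) (Fin 3) ℝ) *ᵥ v = v := by
  have hdet : ((g : Matrix (Fin 3) (Fin 3) ℝ) - 1).det = 0 := by
    have h : ((g : Matrix (Fin 3) (Fin 3) ℝ) - 1).det =
        -((g : Matrix (Fin 3) (Fin 3) ℝ) - 1).det := by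
      -- Here `g - 1 = g * (1 - g)ᵀ`, and negation changes the sign of a determinant of odd size.
      calc ((g : Matrix (Fin 3) (Fin 3) ℝ) - 1).det
          = ((g : Matrix (Fin 3) (Fin 3) ℝ) *
              (-((g : Matrix (Fin 3) (Fin 3) ℝ) - 1)).transpose).det := by
            rw [neg_sub, Matrix.transpose_sub, Matrix.transpose_one, mul_sub, g.mul_transpose,
              mul_one]
        _ = _ := by
            rw [Matrix.det_mul, g.det_eq_one, Matrix.det_transpose, Matrix.det_neg]
            norm_num
    linarith
  obtain ⟨w, hw0, hw⟩ := Matrix.exists_mulVec_eq_zero_iff.2 hdet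
  rw [Matrix.sub_mulVec, Matrix.one_mulVec, sub_eq_zero] at hw
  have hpos : 0 < w 0 ^ 2 + w 1 ^ 2 + w 2 ^ 2 := by
    refine lt_of_le_of_ne (by positivity) fun h => hw0 ?_
    ext i
    fin_cases i <;> simp <;> nlinarith [sq_nonneg (w 0), sq_nonneg (w 1), sq_nonneg (w 2)]
  refine ⟨(√(w 0 ^ 2 + w 1 ^ 2 + w 2 ^ 2))⁻¹ • w, ?_, by rw [Matrix.mulVec_smul, hw]⟩
  simp only [Pi.smul_apply, smul_eq_mul, mul_pow, inv_pow, Real.sq_sqrt hpos.le]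
  field_simp

theorem exists_isRotationAngle (g : SO3) : ∃ α ∈ Set.Icc 0 π, IsRotationAngle g α := by
  obtain ⟨v, hv, hgv⟩ := exists_unit_fixed g
  obtain ⟨P, hP⟩ := exists_SO3_firstColumn hv
  obtain ⟨Q, hQ⟩ : ∃ Q : SO3, (Q : Matrix (Fin 3) (Fin 3) ℝ) =
      (P : Matrix (Fin 3) (Fin 3) ℝ).transpose * g * P := ⟨P⁻¹ * g * P, rfl⟩
  have hgPQ : (g : Matrix (Fin 3) (Fin 3) ℝ) =
      P * Q * (P : Matrix (Fin 3) (Fin 3) ℝ).transpose := by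
    rw [hQ]
    calc (g : Matrix (Fin 3) (Fin 3) ℝ) = (P * (P : Matrix (Fin 3) (Fin 3) ℝ).transpose) * g *
          (P * (P : Matrix (Fin 3) (Fin 3) ℝ).transpose) := by
            rw [P.mul_transpose, one_mul, mul_one]
      _ = _ := by simp only [mul_assoc]
  have hcol : ∀ i, (Q : Matrix (Fin 3) (Fin 3) ℝ) i 0 = (1 : Matrix (Fin 3) (Fin 3) ℝ) i 0 := by
    intro i
    have hPv : (P : Matrix (Fin 3) (Fin 3) ℝ) *ᵥ Pi.single 0 1 = v := by
      ext i
      simp [hP]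
    have h : (Q : Matrix (Fin 3) (Fin 3) ℝ) *ᵥ Pi.single 0 1 = Pi.single 0 1 := by
      rw [hQ, ← Matrix.mulVec_mulVec, hPv, ← Matrix.mulVec_mulVec, hgv, ← hPv,
        Matrix.mulVec_mulVec, P.transpose_mul, Matrix.one_mulVec]
    have := congrFun h i
    rw [Matrix.mulVec_single_one] at this
    simpa [Pi.single_apply, Matrix.one_apply] using this
  obtain ⟨c, s, hcs, hQcs⟩ : ∃ c s : ℝ, c ^ 2 + s ^ 2 = 1 ∧
      (Q : Matrix (Fin 3) (Fin 3) ℝ) = !![1, 0, 0; 0, c, -s; 0, s, c] := by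
    have hrow := fun i j => congrFun (congrFun Q.mul_transpose i) j
    have hcol' := fun i j => congrFun (congrFun Q.transpose_mul i) j
    have hdet := Q.det_eq_one
    have c0 := hcol 0
    have c1 := hcol 1
    have c2 := hcol 2
    have r00 := hrow 0 0
    have k11 := hcol' 1 1
    have k12 := hcol' 1 2
    have k22 := hcol' 2 2
    rw [Matrix.det_fin_three] at hdet
    simp [Matrix.mul_apply, Fin.sum_univ_three] at c0 c1 c2 r00 k11 k12 k22
    have q01 : (Q : Matrix (Fin 3) (Fin 3) ℝ) 0 1 = 0 := by rw [c0] at r00; nlinarith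
    have q02 : (Q : Matrix (Fin 3) (Fin 3) ℝ) 0 2 = 0 := by rw [c0] at r00; nlinarith
    simp only [c0, c1, c2, q01, q02] at hdet k11 k12 k22
    -- Expanded, this is two unit column norms minus twice the determinant: `1 + 1 - 2`.
    have hsum : ((Q : Matrix (Fin 3) (Fin 3) ℝ) 1 1 - (Q : Matrix (Fin 3) (Fin 3) ℝ) 2 2) ^ 2 +
      ((Q : Matrix (Fin 3) (Fin 3) ℝ) 2 1 + (Q : Matrix (Fin 3) (Fin 3) ℝ) 1 2) ^ 2 = 0 := by
      linarith
    have q22 : (Q : Matrix (Fin 3) (Fin 3) ℝ) 2 2 = (Q : Matrix (Fin 3) (Fin 3) ℝ) 1 1 := by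
      nlinarith
    have q12 : (Q : Matrix (Fin 3) (Fin 3) ℝ) 1 2 = -(Q : Matrix (Fin 3) (Fin 3) ℝ) 2 1 := by
      nlinarith
    refine ⟨(Q : Matrix (Fin 3) (Fin 3) ℝ) 1 1, (Q : Matrix (Fin 3) (Fin 3) ℝ) 2 1,
      by linarith, ?_⟩
    ext i j
    fin_cases i <;> fin_cases j <;> simp [c0, c1, c2, q01, q02, q22, q12]
  have hcos : cos (arccos c) = c := cos_arccos (by nlinarith) (by nlinarith)
  have hsin : sin (arccos c) = |s| := by
    rw [sin_arccos, ← hcs, add_sub_cancel_left, Real.sqrt_sq_eq_abs]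
  refine ⟨arccos c, ⟨arccos_nonneg c, arccos_le_pi c⟩, ?_⟩
  rcases abs_choice s with h | h
  · refine ⟨P, ?_⟩
    rw [hgPQ, hQcs, hcos, hsin, h]
  -- If the sine is negative, a half-turn about the third vector reverses the axis and hence the
  -- sign of the angle.
  · obtain ⟨T, hT⟩ : ∃ T : SO3, (T : Matrix (Fin 3) (Fin 3) ℝ) =
        !![-1, 0, 0; 0, -1, 0; 0, 0, 1] := ⟨rotationThd π, by simp [rotationThd]⟩
    refine ⟨P * T, ?_⟩
    have hTQ : (Q : Matrix (Fin 3) (Fin 3) ℝ) = (T : Matrix (Fin 3) (Fin 3) ℝ) *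
        !![1, 0, 0; 0, c, - -s; 0, -s, c] * (T : Matrix (Fin 3) (Fin 3) ℝ).transpose := by
      rw [hQcs, hT]
      ext i j
      fin_cases i <;> fin_cases j <;> simp [Matrix.mul_apply, Fin.sum_univ_three]
    rw [hgPQ, hTQ, hcos, hsin, h]
    change _ = (P : Matrix (Fin 3) (Fin 3) ℝ) * (T : Matrix (Fin 3) (Fin 3) ℝ) * _ *
      ((P : Matrix (Fin 3) (Fin 3) ℝ) * (T : Matrix (Fin 3) (Fin 3) ℝ)).transpose
    rw [Matrix.transpose_mul]
    simp only [mul_assoc]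

end Rotation

/-! ### Integral and closed formulas for the dimensions. -/

section Dimensions

open Real

/-- Weyl's integration formula for the powers of `1 + Tr`. -/
theorem integral_one_add_trace_pow (n : ℕ) :
    ∫ g : SO3, (1 + (g : Matrix (Fin 3) (Fin 3) ℝ).trace) ^ n ∂(haarProb SO3) =
      1 / π * ∫ α in (0 : ℝ)..π, (2 + 2 * cos α) ^ n * (1 - cos α) := by
  induction n with
  | zero => simp [pi_ne_zero]
  | succ n ih =>
    have h1 := integral_one_add_trace_pow_succ n
    have h2 := integral_weyl_shifted_succ n
    rw [ih] at h1
    refine mul_left_cancel₀ (a := (n : ℝ) + 2) (by positivity) ?_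
    rw [h1, mul_left_comm, mul_left_comm ((n : ℝ) + 2), h2]

/-- Weyl's integration formula for the powers of the trace. -/
theorem integral_trace_pow (n : ℕ) :
    ∫ g : SO3, (g : Matrix (Fin 3) (Fin 3) ℝ).trace ^ n ∂(haarProb SO3) =
      1 / π * ∫ α in (0 : ℝ)..π, (1 + 2 * cos α) ^ n * (1 - cos α) := by
  have hct : Continuous fun g : SO3 => (g : Matrix (Fin 3) (Fin 3) ℝ).trace :=
    continuous_subtype_val.matrix_trace
  -- Only moments of `1 + Tr` are known, so `x ^ n` is expanded about `-1`.
  have hexp : ∀ x : ℝ, x ^ n = ∑ k ∈ Finset.range (n + 1),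
      (1 + x) ^ k * ((-1) ^ (n - k) * (n.choose k : ℝ)) := by
    intro x
    conv_lhs => rw [show x = (1 + x) + -1 by ring, add_pow]
    exact Finset.sum_congr rfl fun k _ => mul_assoc _ _ _
  have hexp' : ∀ α : ℝ, (1 + 2 * cos α) ^ n * (1 - cos α) = ∑ k ∈ Finset.range (n + 1),
      (2 + 2 * cos α) ^ k * (1 - cos α) * ((-1) ^ (n - k) * (n.choose k : ℝ)) := by
    intro α
    rw [hexp, Finset.sum_mul, ← add_assoc, one_add_one_eq_two]
    exact Finset.sum_congr rfl fun k _ => by ring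
  simp_rw [hexp', hexp (Matrix.trace _)]
  rw [integral_finsetSum, intervalIntegral.integral_finsetSum, Finset.mul_sum]
  · refine Finset.sum_congr rfl fun k _ => ?_
    rw [integral_mul_const, intervalIntegral.integral_mul_const, integral_one_add_trace_pow,
      mul_assoc]
  · exact fun k _ => Continuous.intervalIntegrable (by fun_prop) _ _
  · exact fun k _ => Continuous.integrable_haarProb (by fun_prop)

theorem hemitropicDim_eq_integral_weyl (n : ℕ) : (hemitropicDim n : ℝ) =
    1 / π * ∫ α in (0 : ℝ)..π, (1 + 2 * cos α) ^ n * (1 - cos α) := by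
  rw [hemitropicDim_eq_integral_trace, integral_trace_pow]

theorem hemitropicDim_eq_integral_polarDomain (n : ℕ) : (hemitropicDim n : ℝ) =
    1 / (2 * π ^ 2) * ∫ u in polarDomain,
      (1 + 2 * cos u.2.2) ^ n * cos u.2.1 * sin (u.2.2 / 2) ^ 2 := by
  rw [setIntegral_polarDomain fun α => (1 + 2 * cos α) ^ n, hemitropicDim_eq_integral_weyl]
  field_simp [pi_ne_zero]

theorem hemitropicDim_eq_sum {n M N : ℕ} (hM : n + 1 ≤ 2 * M) (hN : n + 2 ≤ 2 * N) :
    (hemitropicDim n : ℝ) =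
      3 / 2 * ∑ k ∈ Finset.range M, ((2 * k).choose k : ℝ) * (n.choose (2 * k) : ℝ) -
      1 / 2 * ∑ k ∈ Finset.range N, ((2 * k).choose k : ℝ) * ((n + 1).choose (2 * k) : ℝ) := by
  rw [hemitropicDim_eq_integral_weyl, integral_weyl_eq_sub, integral_one_add_two_mul_cos_pow hM,
    integral_one_add_two_mul_cos_pow (n := n + 1) hN]
  field_simp [pi_ne_zero]

theorem hemitropicDim_two_mul (m : ℕ) : (hemitropicDim (2 * m) : ℝ) =
    ∑ k ∈ Finset.range (m + 1), ((2 * k).choose k : ℝ) *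
      (3 / 2 * ((2 * m).choose (2 * k) : ℝ) - 1 / 2 * ((2 * m + 1).choose (2 * k) : ℝ)) := by
  rw [hemitropicDim_eq_sum (M := m + 1) (N := m + 1) (by omega) (by omega), Finset.mul_sum,
    Finset.mul_sum, ← Finset.sum_sub_distrib]
  exact Finset.sum_congr rfl fun k _ => by ring

theorem hemitropicDim_two_mul_add_one (m : ℕ) : (hemitropicDim (2 * m + 1) : ℝ) =
    ∑ k ∈ Finset.range (m + 1), ((2 * k).choose k : ℝ) *
        (3 / 2 * ((2 * m + 1).choose (2 * k) : ℝ) - 1 / 2 * ((2 * m + 2).choose (2 * k) : ℝ)) -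
      1 / 2 * ((2 * m + 2).choose (m + 1) : ℝ) := by
  rw [hemitropicDim_eq_sum (M := m + 1) (N := m + 1 + 1) (by omega) (by omega),
    -- The second sum has one more term, `k = m + 1`, which becomes the separate central binomial.
    Finset.sum_range_succ _ (m + 1), mul_add, ← sub_sub, Finset.mul_sum, Finset.mul_sum,
    ← Finset.sum_sub_distrib, show 2 * (m + 1) = 2 * m + 2 by ring,
    show 2 * m + 1 + 1 = 2 * m + 2 by ring, Nat.choose_self, Nat.cast_one, mul_one]
  congr 1
  exact Finset.sum_congr rfl fun k _ => by ring

theorem isotropicDim_eq_integral_polarDomain (n : ℕ) : (isotropicDim n : ℝ) =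
    1 / (4 * π ^ 2) * ∫ u in polarDomain,
      (1 + (-1) ^ n) * (1 + 2 * cos u.2.2) ^ n * cos u.2.1 * sin (u.2.2 / 2) ^ 2 := by
  rcases Nat.even_or_odd' n with ⟨m, rfl | rfl⟩
  · rw [isotropicDim_two_mul, hemitropicDim_eq_integral_polarDomain]
    simp only [pow_mul (-1 : ℝ), neg_one_sq, one_pow, mul_assoc, integral_const_mul]
    field_simp
    ring
  · rw [isotropicDim_two_mul_add_one, Odd.neg_one_pow ⟨m, rfl⟩]
    simp

theorem hemitropicDim_table :
    [0, 1, 2, 3, 4, 5, 6, 8, 15, 16, 20].map hemitropicDim =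
      [1, 0, 1, 1, 3, 6, 15, 91, 83097, 227475, 13393689] := by
  have e0 : hemitropicDim 0 = 1 := by
    have h := hemitropicDim_two_mul 0
    norm_num at h
    exact_mod_cast h
  have e1 : hemitropicDim 1 = 0 := by
    have h := hemitropicDim_two_mul_add_one 0
    norm_num [Nat.choose] at h
    exact_mod_cast h
  have e2 : hemitropicDim 2 = 1 := by
    have h := hemitropicDim_two_mul 1
    norm_num [Finset.sum_range_succ, Nat.choose] at h
    exact_mod_cast h
  have e3 : hemitropicDim 3 = 1 := by
    have h := hemitropicDim_two_mul_add_one 1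
    norm_num [Finset.sum_range_succ, Nat.choose] at h
    exact_mod_cast h
  have e4 : hemitropicDim 4 = 3 := by
    have h := hemitropicDim_two_mul 2
    norm_num [Finset.sum_range_succ, Nat.choose] at h
    exact_mod_cast h
  have e5 : hemitropicDim 5 = 6 := by
    have h := hemitropicDim_two_mul_add_one 2
    norm_num [Finset.sum_range_succ, Nat.choose] at h
    exact_mod_cast h
  have e6 : hemitropicDim 6 = 15 := by
    have h := hemitropicDim_two_mul 3
    norm_num [Finset.sum_range_succ, Nat.choose] at h
    exact_mod_cast h
  have e8 : hemitropicDim 8 = 91 := by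
    have h := hemitropicDim_two_mul 4
    norm_num [Finset.sum_range_succ, Nat.choose] at h
    exact_mod_cast h
  have e15 : hemitropicDim 15 = 83097 := by
    have h := hemitropicDim_two_mul_add_one 7
    norm_num [Finset.sum_range_succ, Nat.choose] at h
    exact_mod_cast h
  have e16 : hemitropicDim 16 = 227475 := by
    have h := hemitropicDim_two_mul 8
    norm_num [Finset.sum_range_succ, Nat.choose] at h
    exact_mod_cast h
  have e20 : hemitropicDim 20 = 13393689 := by
    have h := hemitropicDim_two_mul 10
    norm_num [Finset.sum_range_succ, Nat.choose] at h
    exact_mod_cast h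
  simp [e0, e1, e2, e3, e4, e5, e6, e8, e15, e16, e20]

theorem isotropicDim_table :
    [0, 1, 2, 3, 4, 5, 6, 8, 15, 16, 20].map isotropicDim =
      [1, 0, 1, 0, 3, 0, 15, 91, 0, 227475, 13393689] := by
  have h := hemitropicDim_table
  simp only [List.map_cons, List.map_nil, List.cons.injEq, and_true] at h ⊢
  obtain ⟨h0, -, h2, -, h4, -, h6, h8, -, h16, h20⟩ := h
  exact ⟨(isotropicDim_two_mul 0).trans h0, isotropicDim_two_mul_add_one 0,
    (isotropicDim_two_mul 1).trans h2, isotropicDim_two_mul_add_one 1,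
    (isotropicDim_two_mul 2).trans h4, isotropicDim_two_mul_add_one 2,
    (isotropicDim_two_mul 3).trans h6, (isotropicDim_two_mul 4).trans h8,
    isotropicDim_two_mul_add_one 7, (isotropicDim_two_mul 8).trans h16,
    (isotropicDim_two_mul 10).trans h20⟩

end Dimensions

theorem mainTheorem5 :
    -- every rotation has an angle in `[0, π]`, and the trace is `1 + 2 cos α` for any such angle
    (∀ g : SO3, ∃ α ∈ Set.Icc 0 Real.pi, IsRotationAngle g α) ∧
    (∀ (g : SO3) (α : ℝ), IsRotationAngle g α →
      (g : Matrix (Fin 3) (Fin 3) ℝ).trace = 1 + 2 * Real.cos α) ∧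
    -- the hemitropic dimension as an integral against the normalised Haar measure of `SO(3)`
    (∀ n : ℕ, (hemitropicDim n : ℝ) =
      ∫ g : SO3, (g : Matrix (Fin 3) (Fin 3) ℝ).trace ^ n ∂(haarProb SO3)) ∧
    (∀ (n : ℕ) (α : SO3 → ℝ), (∀ g, IsRotationAngle g (α g)) →
      (hemitropicDim n : ℝ) = ∫ g : SO3, (1 + 2 * Real.cos (α g)) ^ n ∂(haarProb SO3)) ∧
    -- the same integral in the polar parameters `u = (φ, ψ, α)`
    (∀ n : ℕ, (hemitropicDim n : ℝ) =
      1 / (2 * Real.pi ^ 2) * ∫ u in polarDomain,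
        (1 + 2 * Real.cos u.2.2) ^ n * Real.cos u.2.1 * Real.sin (u.2.2 / 2) ^ 2) ∧
    -- closed formulas for `D_{2m}` and `D_{2m+1}`
    (∀ m : ℕ, (hemitropicDim (2 * m) : ℝ) =
      ∑ k ∈ Finset.range (m + 1), ((2 * k).choose k : ℝ) *
        (3 / 2 * ((2 * m).choose (2 * k) : ℝ) - 1 / 2 * ((2 * m + 1).choose (2 * k) : ℝ))) ∧
    (∀ m : ℕ, (hemitropicDim (2 * m + 1) : ℝ) =
      ∑ k ∈ Finset.range (m + 1), ((2 * k).choose k : ℝ) *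
        (3 / 2 * ((2 * m + 1).choose (2 * k) : ℝ)
          - 1 / 2 * ((2 * m + 2).choose (2 * k) : ℝ))
      - 1 / 2 * ((2 * m + 2).choose (m + 1) : ℝ)) ∧
    -- the isotropic dimension
    (∀ n : ℕ, (isotropicDim n : ℝ) =
      ∫ g : O3, (g : Matrix (Fin 3) (Fin 3) ℝ).trace ^ n ∂(haarProb O3)) ∧
    (∀ n : ℕ, (isotropicDim n : ℝ) =
      1 / (4 * Real.pi ^ 2) * ∫ u in polarDomain,
        (1 + (-1) ^ n) * (1 + 2 * Real.cos u.2.2) ^ n * Real.cos u.2.1 *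
          Real.sin (u.2.2 / 2) ^ 2) ∧
    (∀ m : ℕ, isotropicDim (2 * m) = hemitropicDim (2 * m)) ∧
    (∀ m : ℕ, isotropicDim (2 * m + 1) = 0) ∧
    -- the table of values for `n = 0, 1, 2, 3, 4, 5, 6, 8, 15, 16, 20`
    [0, 1, 2, 3, 4, 5, 6, 8, 15, 16, 20].map hemitropicDim =
      [1, 0, 1, 1, 3, 6, 15, 91, 83097, 227475, 13393689] ∧
    [0, 1, 2, 3, 4, 5, 6, 8, 15, 16, 20].map isotropicDim =
      [1, 0, 1, 0, 3, 0, 15, 91, 0, 227475, 13393689] := by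
  refine ⟨exists_isRotationAngle, fun g α h => h.trace_eq, hemitropicDim_eq_integral_trace,
    fun n α hα => ?_, hemitropicDim_eq_integral_polarDomain, hemitropicDim_two_mul,
    hemitropicDim_two_mul_add_one, isotropicDim_eq_integral_trace,
    isotropicDim_eq_integral_polarDomain, isotropicDim_two_mul, isotropicDim_two_mul_add_one,
    hemitropicDim_table, isotropicDim_table⟩
  -- The integrand equals `Tr ^ n` pointwise, so the choice of angles need not be measurable.
  simp_rw [hemitropicDim_eq_integral_trace, fun g => (hα g).trace_eq]
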